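/- **Theorem 3 (approximate smoothness of the average reward).** Let $\mathcal M=(\mathcal S,\mathcal A,r,P,\rho)$ be a Markov decision process with finite state space $\mathcal S$, finite action space $\mathcal A$ of size $A$, rewards $r:\mathcal S\times\mathcal A\to[0,1]$, transition probabilities $P(\cdot\mid s,a)$ and initial state distribution $\rho$. Assume that $\mathcal M$ is ergodic: for every policy $\pi$ (a map from states to probability distributions on $\mathcal A$), the Markov chain on $\mathcal S$ with transition matrix $P^\pi(s,s')=\sum_a P(s'\mid s,a)\pi(a\mid s)$ is irreducible and aperiodic; let $d^\pi$ be its unique stationary distribution. Let $(\pi_\theta)_{\theta\in\mathbb R^d}$ be a family of policies such that, for all $s,a$, $\pi_\theta(a\mid s)>0$ for every $\theta$, the function $\theta\mapsto\log\pi_\theta(a\mid s)$ is twice differentiable on $\mathbb R^d$, and for all $\theta$ $$\|\nabla_\theta\log\pi_\theta(a\mid s)\|\le G,\qquad \|\nabla^2_\theta\log\pi_\theta(a\mid s)\|\le B,$$ with the Euclidean norm and the operator norm, respectively. Put $$J^\pi=\lim_{n\to\infty}\frac1n\,\mathbb E_\pi\Big[\sum_{t=0}^{n-1}r(s_t,a_t)\,\Big|\,s_0\sim\rho\Big],\qquad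 J(\theta)=J^{\pi_\theta},\qquad J^*=\sup_\pi J^\pi,$$ $$t_{\mathrm{mix}}=\sup_{\theta}\min\Big\{t\ge1:\ \|(P^{\pi_\theta})^t(s,\cdot)-d^{\pi_\theta}\|_1\le\tfrac14\ \ \forall s\in\mathcal S\Big\},\qquad t_{\mathrm{hit}}=\sup_\theta\max_{s\in\mathcal S}\frac1{d^{\pi_\theta}(s)}.$$ Then $J$ is differentiable on $\mathbb R^d$, and for every integer $T\ge1$ there is a number $L\ge0$ such that for all $\theta_0,\theta,\bar\theta\in\mathbb R^d$ there is $\Delta_L\ge0$ with $$J^*-J(\bar\theta)\le J^*-J(\theta)-\nabla J(\theta)^\top(\bar\theta-\theta)+\frac L2\|\bar\theta-\theta\|^2+\Delta_L,$$ where $$L\le C\left(\sqrt A\,G^2t_{\mathrm{mix}}^2t_{\mathrm{hit}}(\log T)^3+B\,t_{\mathrm{mix}}\log T\right),\qquad \Delta_L\le C\,\frac{A\,G\,t_{\mathrm{mix}}\left(\|\theta-\theta_0\|+\|\bar\theta-\theta_0\|\right)}{T^4},$$ and $C>0$ is a universal constant, independent of the MDP, the parametrization, $d$, $G$, $B$,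 $T$ and of $\theta_0,\theta,\bar\theta$. -/

import Mathlib

noncomputable section

/-- A finite Markov decision process: rewards in `[0, 1]`, transition probabilities
`P s a : Δ(S)`, and an initial state distribution `ρ : Δ(S)`. -/
structure MDP (S A : Type*) [Fintype S] [Fintype A] where
  r : S → A → ℝ
  r_mem : ∀ s a, r s a ∈ Set.Icc (0 : ℝ) 1
  P : S → A → stdSimplex ℝ S
  ρ : stdSimplex ℝ S

/-- A (stationary, randomized) policy `S → Δ(A)`; `π s a` is the probability `π(a | s)`. -/
abbrev Policy (S A : Type*) [Fintype A] := S → stdSimplex ℝ A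

/-- A Markov chain is aperiodic if for every state `s` the greatest common divisor of the
return times `n ≥ 1` with `Kⁿ(s, s) > 0` equals `1`. -/
def IsAperiodic {S : Type*} [Fintype S] [DecidableEq S] (K : Matrix S S ℝ) : Prop :=
  ∀ s, Nat.setGcd {n : ℕ | 1 ≤ n ∧ 0 < (K ^ n) s s} = 1

/-- `d` is a stationary distribution of `K`: a probability vector with `Kᵀ d = d`. -/
def IsStationaryDist {S : Type*} [Fintype S] (K : Matrix S S ℝ) (d : S → ℝ) : Prop :=
  d ∈ stdSimplex ℝ S ∧ K.transpose.mulVec d = d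

namespace MDP

variable {S A : Type*} [Fintype S] [Fintype A] (M : MDP S A)

/-- The state transition matrix `P^π(s, s') = ∑ₐ P(s' | s, a) π(a | s)`. -/
def transition (π : Policy S A) : Matrix S S ℝ :=
  Matrix.of fun s s' => ∑ a, M.P s a s' * π s a

/-- The MDP is ergodic: the chain induced by *every* policy is irreducible and aperiodic. -/
def IsErgodic [DecidableEq S] : Prop :=
  ∀ π : Policy S A, (M.transition π).IsIrreducible ∧ IsAperiodic (M.transition π)

/-- The stationary distribution `d^π` (unique when the MDP is ergodic). -/
def statDist (π : Policy S A) : S → ℝ :=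
  Classical.epsilon (IsStationaryDist (M.transition π))

/-- The probability of the trajectory `τ = (s₀, a₀), …, (sₙ, aₙ)` under `π`, with
`s₀ ∼ ρ`, `aₜ ∼ π(· | sₜ)`, `sₜ₊₁ ∼ P(· | sₜ, aₜ)`. -/
def trajProb (π : Policy S A) (n : ℕ) (τ : Fin (n + 1) → S × A) : ℝ :=
  M.ρ (τ 0).1 * (∏ t : Fin (n + 1), π (τ t).1 (τ t).2) *
    ∏ t : Fin n, M.P (τ t.castSucc).1 (τ t.castSucc).2 (τ t.succ).1

/-- The expected total reward `E[∑_{t=0}^{n} r(sₜ, aₜ) | s₀ ∼ ρ]` under `π`. -/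
def expReward (π : Policy S A) (n : ℕ) : ℝ :=
  ∑ τ : Fin (n + 1) → S × A, M.trajProb π n τ * ∑ t : Fin (n + 1), M.r (τ t).1 (τ t).2

/-- The long-term average reward `J^π = lim_{n → ∞} (1/n) E[∑_{t=0}^{n-1} r(sₜ, aₜ) | s₀ ∼ ρ]`
(along `n + 1`). -/
def avgReward (π : Policy S A) : ℝ :=
  Filter.limUnder Filter.atTop fun n : ℕ => M.expReward π n / ((n : ℝ) + 1)

/-- The optimal long-term average reward `J*`. -/
def optReward : ℝ := ⨆ π : Policy S A, M.avgReward π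

/-- The mixing time of a policy: the least `t ≥ 1` such that the `ℓ¹` distance of
`(P^π)ᵗ(s, ·)` to `d^π` is at most `1/4` for every state `s`. -/
def mixTime [DecidableEq S] (π : Policy S A) : ℕ :=
  sInf {t : ℕ | 1 ≤ t ∧ ∀ s, ∑ s', |(M.transition π ^ t) s s' - M.statDist π s'| ≤ 1 / 4}

/-- The overall mixing time of a parametrized family of policies, `sup_θ t_mix^θ`. -/
def tMix [DecidableEq S] {Θ : Type*} (π : Θ → Policy S A) : ℕ :=
  ⨆ θ, M.mixTime (π θ)

/-- The hitting time of a policy, `max_s 1 / d^π(s)`. -/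
def hitTime (π : Policy S A) : ℝ :=
  ⨆ s, 1 / M.statDist π s

/-- The overall hitting time of a parametrized family of policies, `sup_θ t_hit^θ`. -/
def tHit {Θ : Type*} (π : Θ → Policy S A) : ℝ :=
  ⨆ θ, M.hitTime (π θ)

end MDP

/-- Regularity of a policy parametrization by `θ ∈ ℝᵈ`: all action probabilities are positive,
`θ ↦ log π_θ(a | s)` is twice differentiable, its gradient (the score) is bounded by `G` and
its Hessian is bounded by `B` in operator norm. -/
structure ScoreBounds {S A : Type*} [Fintype A] {d : ℕ}
    (π : EuclideanSpace ℝ (Fin d) → Policy S A) (G B : ℝ) : Prop where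
  pos : ∀ θ s a, 0 < π θ s a
  diff_log : ∀ s a, Differentiable ℝ fun θ => Real.log (π θ s a)
  diff_score : ∀ s a, Differentiable ℝ (gradient fun θ => Real.log (π θ s a))
  score_le : ∀ θ s a, ‖gradient (fun θ' => Real.log (π θ' s a)) θ‖ ≤ G
  hessian_le : ∀ θ s a, ‖fderiv ℝ (gradient fun θ' => Real.log (π θ' s a)) θ‖ ≤ B

end

/-! ### Stochastic matrices, stationary distributions and the Poisson equation -/

section MarkovChain

open Matrix

variable {S : Type*} [Fintype S] {K : Matrix S S ℝ} {d : S → ℝ}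

/-! The average reward is smooth in the classical sense, with curvature of order `m²G² + mB` where
`m = M.tMix π`. For `T ≥ 2` the logarithms are bounded below, so `Δ = 0` works, and the factors
`√A`, `t_hit` and `log T` of the claimed bound are mere slack. For `T = 1` the logarithms vanish, `L
= 0` is forced, and the Lipschitz bound for `J` is absorbed into `Δ`.

The engine is the Poisson equation `h - K h = f - d·f`. After `m` steps the chain contracts
mean-zero functions by `1/4`, so a solution has size `O(m)` (`exists_poisson_solution`). This yields
two facts: the stationary distribution is Lipschitz in the policy with constant `O(m)`
(`abs_statDist_dotProduct_sub_le`), and the performance difference formula `J' - J = d'·∑ₐ (π' - π)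
Q` holds with `|Q| ≤ 3m` (`exists_actionValue`).

In that formula `π' - π` is replaced by its linear part, with error `(G² + B)‖θ' - θ‖²`
(`abs_sum_taylor_remainder_le`), and `d'` by `d`, with error `O(mG‖θ' - θ‖)` against a function of
size `O(mG‖θ' - θ‖)`. What remains is the policy gradient; the quadratic remainder also proves
differentiability (`exists_gradient_bounds`). -/

lemma abs_sum_mul_le_of_mem_stdSimplex {w : S → ℝ} (hw : w ∈ stdSimplex ℝ S) {f : S → ℝ} {c : ℝ}
    (hf : ∀ s, |f s| ≤ c) : |∑ s, w s * f s| ≤ c := by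
  calc |∑ s, w s * f s| ≤ ∑ s, |w s * f s| := Finset.abs_sum_le_sum_abs _ _
    _ ≤ ∑ s, w s * c := Finset.sum_le_sum fun s _ => by
        rw [abs_mul, abs_of_nonneg (hw.1 s)]
        exact mul_le_mul_of_nonneg_left (hf s) (hw.1 s)
    _ = c := by rw [← Finset.sum_mul, hw.2, one_mul]

namespace IsStationaryDist

lemma dotProduct_mulVec (hd : IsStationaryDist K d) (f : S → ℝ) : d ⬝ᵥ (K *ᵥ f) = d ⬝ᵥ f := by
  rw [Matrix.dotProduct_mulVec, ← Matrix.mulVec_transpose, hd.2]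

lemma dotProduct_const (hd : IsStationaryDist K d) (c : ℝ) : (d ⬝ᵥ fun _ => c) = c := by
  simp [dotProduct, ← Finset.sum_mul, hd.1.2]

lemma abs_dotProduct_le (hd : IsStationaryDist K d) (f : S → ℝ) : |d ⬝ᵥ f| ≤ ‖f‖ :=
  abs_sum_mul_le_of_mem_stdSimplex hd.1 fun s => norm_le_pi_norm f s

lemma dotProduct_sub_const (hd : IsStationaryDist K d) (f : S → ℝ) :
    (d ⬝ᵥ fun s => f s - d ⬝ᵥ f) = 0 := by
  have : (fun s => f s - d ⬝ᵥ f) = f - fun _ => d ⬝ᵥ f := rfl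
  rw [this, dotProduct_sub, hd.dotProduct_const, sub_self]

end IsStationaryDist

variable [DecidableEq S]

lemma row_mem_stdSimplex (hK : K ∈ rowStochastic ℝ S) (s : S) : K s ∈ stdSimplex ℝ S :=
  ⟨fun _ => nonneg_of_mem_rowStochastic hK, sum_row_of_mem_rowStochastic hK s⟩

lemma norm_mulVec_le_of_mem_rowStochastic (hK : K ∈ rowStochastic ℝ S) (f : S → ℝ) :
    ‖K *ᵥ f‖ ≤ ‖f‖ :=
  (pi_norm_le_iff_of_nonneg (norm_nonneg f)).2 fun s =>
    abs_sum_mul_le_of_mem_stdSimplex (row_mem_stdSimplex hK s) fun s' => norm_le_pi_norm f s'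

lemma IsStationaryDist.dotProduct_pow_mulVec (hd : IsStationaryDist K d) (n : ℕ) (f : S → ℝ) :
    d ⬝ᵥ ((K ^ n) *ᵥ f) = d ⬝ᵥ f := by
  induction n with
  | zero => simp
  | succ n ih => rw [pow_succ', ← mulVec_mulVec, hd.dotProduct_mulVec, ih]

/-- Every stochastic matrix has a stationary distribution: the normalized absolute value of a
left fixed vector. -/
lemma exists_isStationaryDist [Nonempty S] (hK : K ∈ rowStochastic ℝ S) :
    ∃ d, IsStationaryDist K d := by
  -- Constants are right fixed vectors, so `1 - K` is singular and has a left kernel too.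
  have hdet : (1 - K).det = 0 := by
    refine exists_mulVec_eq_zero_iff.1 ⟨1, one_ne_zero, ?_⟩
    rw [sub_mulVec, one_mulVec, one_vecMul_of_mem_rowStochastic hK, sub_self]
  obtain ⟨v, hv0, hv⟩ := exists_vecMul_eq_zero_iff.2 hdet
  have hv' : ∀ s', ∑ s, v s * K s s' = v s' := by
    intro s'
    have := congrFun hv s'
    rw [vecMul_sub, vecMul_one] at this
    exact (sub_eq_zero.1 this).symm
  have hle : ∀ s', |v s'| ≤ ∑ s, |v s| * K s s' := by
    intro s'
    rw [← hv' s']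
    refine (Finset.abs_sum_le_sum_abs _ _).trans (Finset.sum_le_sum fun s _ => ?_)
    rw [abs_mul, abs_of_nonneg (nonneg_of_mem_rowStochastic hK (i := s) (j := s'))]
  have hsum : ∑ s', |v s'| = ∑ s', ∑ s, |v s| * K s s' := by
    rw [Finset.sum_comm]
    simp [← Finset.mul_sum, sum_row_of_mem_rowStochastic hK]
  -- A pointwise inequality between vectors of equal total mass is an equality.
  have heq : ∀ s', ∑ s, |v s| * K s s' = |v s'| := fun s' =>
    (((Finset.sum_eq_sum_iff_of_le fun s _ => hle s).1 hsum) s' (Finset.mem_univ _)).symm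
  have hpos : 0 < ∑ s, |v s| := by
    obtain ⟨s, hs⟩ := Function.ne_iff.1 hv0
    exact Finset.sum_pos' (fun _ _ => abs_nonneg _) ⟨s, Finset.mem_univ _, abs_pos.2 hs⟩
  refine ⟨fun s => |v s| / ∑ s, |v s|, ⟨fun s => by positivity, ?_⟩, ?_⟩
  · rw [← Finset.sum_div, div_self hpos.ne']
  · ext s'
    rw [mulVec_transpose]
    simp only [vecMul, dotProduct, div_mul_eq_mul_div, ← Finset.sum_div, heq]

/-- An irreducible aperiodic chain has a positive power. -/
lemma exists_pow_pos_of_irreducible_of_aperiodic (hK : K.IsIrreducible) (hap : IsAperiodic K) :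
    ∃ N > 0, ∀ s s', 0 < (K ^ N) s s' := by
  have hpow_nonneg : ∀ n s s', 0 ≤ (K ^ n) s s' := fun n s s' =>
    pow_apply_nonneg hK.nonneg n s s'
  have hmul : ∀ {m n s t u}, 0 < (K ^ m) s t → 0 < (K ^ n) t u → 0 < (K ^ (m + n)) s u := by
    intro m n s t u h1 h2
    rw [pow_add, mul_apply]
    exact Finset.sum_pos' (fun x _ => mul_nonneg (hpow_nonneg _ _ _) (hpow_nonneg _ _ _))
      ⟨t, Finset.mem_univ _, mul_pos h1 h2⟩
  have hret : ∀ s, ∃ n, ∀ m ≥ n, 0 < (K ^ m) s s := by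
    intro s
    -- Return times are closed under addition, and an additive semigroup with gcd 1 contains all
    -- large integers.
    obtain ⟨n, hn⟩ := Nat.exists_mem_closure_of_ge {n : ℕ | 1 ≤ n ∧ 0 < (K ^ n) s s}
    refine ⟨n, fun m hm => ?_⟩
    refine AddSubmonoid.closure_induction (motive := fun m _ => 0 < (K ^ m) s s)
      (fun x hx => hx.2) (by simp) (fun x y _ _ hx hy => hmul hx hy)
      (hn m hm (by rw [hap s]; exact one_dvd m))
  choose n hn using hret
  choose k _ hk using (isIrreducible_iff_exists_pow_pos hK.nonneg).1 hK
  -- This exponent exceeds every `n s + k s s'`; the surplus is spent on loops at `s`.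
  refine ⟨(∑ s, n s) + (∑ s, ∑ s', k s s') + 1, by omega, fun s s' => ?_⟩
  have h1 : n s ≤ ∑ s, n s := Finset.single_le_sum (fun _ _ => Nat.zero_le _) (Finset.mem_univ s)
  have h2 : k s s' ≤ ∑ s, ∑ s', k s s' :=
    (Finset.single_le_sum (f := fun s' => k s s') (fun _ _ => Nat.zero_le _)
      (Finset.mem_univ s')).trans
    (Finset.single_le_sum (f := fun s => ∑ s', k s s') (fun _ _ => Nat.zero_le _)
      (Finset.mem_univ s))
  obtain ⟨e, he⟩ := Nat.exists_eq_add_of_le (show n s + k s s' ≤ _ from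
    (add_le_add h1 h2).trans (Nat.le_add_right _ 1))
  rw [he, show n s + k s s' + e = (n s + e) + k s s' by omega]
  exact hmul (hn s _ (Nat.le_add_right _ _)) (hk s s')

lemma IsStationaryDist.pos (hd : IsStationaryDist K d) {N : ℕ}
    (hN : ∀ s s', 0 < (K ^ N) s s') (s : S) : 0 < d s := by
  have h := hd.dotProduct_pow_mulVec N (Pi.single s 1)
  rw [mulVec_single_one, dotProduct_single_one] at h
  rw [← h]
  have hsum := hd.1.2
  obtain ⟨t, -, ht⟩ : ∃ t ∈ Finset.univ, d t ≠ 0 :=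
    Finset.exists_ne_zero_of_sum_ne_zero (by rw [hsum]; exact one_ne_zero)
  exact Finset.sum_pos' (fun x _ => mul_nonneg (hd.1.1 x) (hN x s).le)
    ⟨t, Finset.mem_univ _, mul_pos ((hd.1.1 t).lt_of_ne' ht) (hN t s)⟩

/-- If `K (s, ·)` dominates `δ d` then `K` contracts the functions of mean zero. -/
lemma norm_mulVec_le_of_minorization (hK : K ∈ rowStochastic ℝ S) (hd : d ∈ stdSimplex ℝ S)
    {δ : ℝ} (hδ : ∀ s s', δ * d s' ≤ K s s') {f : S → ℝ} (hf : d ⬝ᵥ f = 0) (hδ1 : δ ≤ 1) :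
    ‖K *ᵥ f‖ ≤ (1 - δ) * ‖f‖ := by
  refine (pi_norm_le_iff_of_nonneg (mul_nonneg (by linarith) (norm_nonneg f))).2 fun s => ?_
  -- As `f` has mean zero, `δ d` can be removed from the row at no cost, leaving a nonnegative row
  -- of mass `1 - δ`.
  have h : (K *ᵥ f) s = ∑ s', (K s s' - δ * d s') * f s' := by
    simp only [sub_mul, Finset.sum_sub_distrib, mul_assoc, ← Finset.mul_sum]
    have : ∑ i, d i * f i = 0 := hf
    rw [this, mul_zero, sub_zero]
    rfl
  rw [h, Real.norm_eq_abs]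
  calc |∑ s', (K s s' - δ * d s') * f s'| ≤ ∑ s', |(K s s' - δ * d s') * f s'| :=
        Finset.abs_sum_le_sum_abs _ _
    _ ≤ ∑ s', (K s s' - δ * d s') * ‖f‖ := Finset.sum_le_sum fun s' _ => by
        rw [abs_mul, abs_of_nonneg (sub_nonneg.2 (hδ s s'))]
        exact mul_le_mul_of_nonneg_left (norm_le_pi_norm f s') (sub_nonneg.2 (hδ s s'))
    _ = (1 - δ) * ‖f‖ := by
        rw [← Finset.sum_mul, Finset.sum_sub_distrib, ← Finset.mul_sum, hd.2,
          sum_row_of_mem_rowStochastic hK, mul_one]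

/-- Convergence to stationarity in total `ℓ¹` distance, along multiples of a positive power. -/
lemma exists_pow_sub_stationary_lt [Nonempty S] (hK : K ∈ rowStochastic ℝ S)
    (hd : IsStationaryDist K d) {N : ℕ} (hN0 : 0 < N) (hN : ∀ s s', 0 < (K ^ N) s s')
    {ε : ℝ} (hε : 0 < ε) :
    ∃ t, 1 ≤ t ∧ ∑ s, ∑ s', |(K ^ t) s s' - d s'| < ε := by
  obtain ⟨⟨s₀, s₁⟩, hmin⟩ := Finite.exists_min fun p : S × S => (K ^ N) p.1 p.2
  set δ := (K ^ N) s₀ s₁ with hδdef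
  have hδ : 0 < δ := hN _ _
  have hKN := pow_mem hK N
  have hδ1 : δ ≤ 1 := le_one_of_mem_rowStochastic hKN
  -- Doeblin's condition: `δ` is the least entry and `d s' ≤ 1`.
  have hminor : ∀ s s', δ * d s' ≤ (K ^ N) s s' := fun s s' =>
    (mul_le_of_le_one_right hδ.le (by
      rw [← hd.1.2]
      exact Finset.single_le_sum (fun x _ => hd.1.1 x) (Finset.mem_univ s'))).trans
      (hmin (s, s'))
  have hcontr : ∀ (k : ℕ) (f : S → ℝ), d ⬝ᵥ f = 0 →
      ‖(K ^ (N * k)) *ᵥ f‖ ≤ (1 - δ) ^ k * ‖f‖ := by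
    intro k f hf
    induction k with
    | zero => simp
    | succ k ih =>
      rw [Nat.mul_succ, add_comm, pow_add, ← mulVec_mulVec, pow_succ', mul_assoc]
      refine (norm_mulVec_le_of_minorization hKN hd.1 hminor ?_ hδ1).trans
        (mul_le_mul_of_nonneg_left ih (by linarith))
      rw [hd.dotProduct_pow_mulVec, hf]
  have hlim : ∀ s s', Filter.Tendsto (fun k => |(K ^ (N * k)) s s' - d s'|) Filter.atTop
      (nhds 0) := by
    intro s s'
    set f : S → ℝ := fun s => (Pi.single s' 1 : S → ℝ) s - d ⬝ᵥ (Pi.single s' 1 : S → ℝ) with hf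
    have hval : ∀ k, ((K ^ (N * k)) *ᵥ f) s = (K ^ (N * k)) s s' - d s' := by
      intro k
      have hconst : (K ^ (N * k)) *ᵥ (fun _ => d s') = fun _ => d s' := by
        ext x
        simp [mulVec, dotProduct, ← Finset.sum_mul,
          sum_row_of_mem_rowStochastic (pow_mem hK (N * k))]
      have : f = Pi.single s' 1 - fun _ => d s' := by
        rw [hf, dotProduct_single_one]; rfl
      rw [this, mulVec_sub, hconst, mulVec_single_one]
      rfl
    have hgeo : Filter.Tendsto (fun k : ℕ => (1 - δ) ^ k * ‖f‖) Filter.atTop (nhds 0) := by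
      simpa using (tendsto_pow_atTop_nhds_zero_of_lt_one (r := 1 - δ) (by linarith)
        (by linarith)).mul_const ‖f‖
    refine squeeze_zero (fun _ => abs_nonneg _) (fun k => ?_) hgeo
    rw [← hval k]
    exact (norm_le_pi_norm _ s).trans (hcontr k f (hd.dotProduct_sub_const _))
  have hsum : Filter.Tendsto (fun k => ∑ s, ∑ s', |(K ^ (N * k)) s s' - d s'|) Filter.atTop
      (nhds 0) := by
    simpa using tendsto_finsetSum (Finset.univ : Finset S) fun s _ =>
      tendsto_finsetSum (Finset.univ : Finset S) fun s' _ => hlim s s'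
  obtain ⟨k, hk, hk1⟩ := ((hsum.eventually_lt_const hε).and (Filter.eventually_ge_atTop 1)).exists
  exact ⟨N * k, Nat.mul_pos hN0 hk1, hk⟩

/-- A chain that is `ℓ¹`-close to stationarity after `m` steps contracts functions of mean zero. -/
lemma norm_pow_mulVec_le_of_mixing {m : ℕ}
    (hmix : ∀ s, ∑ s', |(K ^ m) s s' - d s'| ≤ 1 / 4) {f : S → ℝ} (hf : d ⬝ᵥ f = 0) :
    ‖(K ^ m) *ᵥ f‖ ≤ 1 / 4 * ‖f‖ := by
  refine (pi_norm_le_iff_of_nonneg (by positivity)).2 fun s => ?_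
  have h : ((K ^ m) *ᵥ f) s = ∑ s', ((K ^ m) s s' - d s') * f s' := by
    simp only [sub_mul, Finset.sum_sub_distrib]
    have : ∑ i, d i * f i = 0 := hf
    rw [this, sub_zero]
    rfl
  rw [h, Real.norm_eq_abs]
  calc |∑ s', ((K ^ m) s s' - d s') * f s'| ≤ ∑ s', |((K ^ m) s s' - d s') * f s'| :=
        Finset.abs_sum_le_sum_abs _ _
    _ ≤ ∑ s', |(K ^ m) s s' - d s'| * ‖f‖ := Finset.sum_le_sum fun s' _ => by
        rw [abs_mul]
        exact mul_le_mul_of_nonneg_left (norm_le_pi_norm f s') (abs_nonneg _)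
    _ ≤ 1 / 4 * ‖f‖ := by
        rw [← Finset.sum_mul]
        exact mul_le_mul_of_nonneg_right (hmix s) (norm_nonneg f)

/-- Telescoping: it both bounds solutions of the Poisson equation and reduces Cesàro sums of rewards
to boundary terms. -/
lemma sum_pow_mulVec_sub (h : S → ℝ) (n : ℕ) :
    ∑ t ∈ Finset.range n, (K ^ t) *ᵥ (h - K *ᵥ h) = h - (K ^ n) *ᵥ h := by
  induction n with
  | zero => simp
  | succ n ih =>
    rw [Finset.sum_range_succ, ih, mulVec_sub, mulVec_mulVec, ← pow_succ]
    abel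

/-- Solution of the Poisson equation, with a bound in terms of the mixing time. -/
lemma exists_poisson_solution (hK : K ∈ rowStochastic ℝ S) (hd : IsStationaryDist K d) {m : ℕ}
    (hmix : ∀ s, ∑ s', |(K ^ m) s s' - d s'| ≤ 1 / 4) {f : S → ℝ} (hf : d ⬝ᵥ f = 0) :
    ∃ h : S → ℝ, h - K *ᵥ h = f ∧ ‖h‖ ≤ 4 / 3 * m * ‖f‖ := by
  have hbound : ∀ h : S → ℝ, d ⬝ᵥ h = 0 → ‖h‖ ≤ 4 / 3 * m * ‖h - K *ᵥ h‖ := by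
    intro h hh
    have h1 : ‖h - (K ^ m) *ᵥ h‖ ≤ m * ‖h - K *ᵥ h‖ := by
      rw [← sum_pow_mulVec_sub]
      refine (norm_sum_le_of_le _ fun t _ =>
        norm_mulVec_le_of_mem_rowStochastic (pow_mem hK t) _).trans ?_
      simp
    have h2 := norm_pow_mulVec_le_of_mixing hmix hh
    have h3 : ‖h‖ ≤ ‖h - (K ^ m) *ᵥ h‖ + ‖(K ^ m) *ᵥ h‖ := by
      simpa using norm_add_le (h - (K ^ m) *ᵥ h) ((K ^ m) *ᵥ h)
    linarith
  -- Adding the rank-one map `h ↦ d·h` makes `1 - K` injective, hence surjective in finite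
  -- dimension; it preserves means, so a preimage of `f` has mean zero and solves the original
  -- equation.
  let Φ : (S → ℝ) →ₗ[ℝ] (S → ℝ) :=
    { toFun := fun h => h - K *ᵥ h + fun _ => d ⬝ᵥ h
      map_add' := fun x y => by
        ext s
        simp [mulVec_add, dotProduct_add]
        ring
      map_smul' := fun c x => by
        ext s
        simp [mulVec_smul, dotProduct_smul]
        ring }
  have hΦ : ∀ h, Φ h = h - K *ᵥ h + fun _ => d ⬝ᵥ h := fun _ => rfl
  have hmean : ∀ h, d ⬝ᵥ Φ h = d ⬝ᵥ h := fun h => by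
    rw [hΦ, dotProduct_add, dotProduct_sub, hd.dotProduct_mulVec, hd.dotProduct_const]
    ring
  have hinj : Function.Injective Φ := by
    refine (injective_iff_map_eq_zero Φ).2 fun h hh => ?_
    have h0 : d ⬝ᵥ h = 0 := by rw [← hmean, hh, dotProduct_zero]
    have h1 : h - K *ᵥ h = 0 := by
      have := hΦ h
      rw [hh, h0] at this
      rw [this]
      ext s
      simp
    have := hbound h h0
    rw [h1, norm_zero, mul_zero] at this
    exact norm_le_zero_iff.1 this
  obtain ⟨h, hh⟩ := LinearMap.surjective_of_injective hinj f
  have h0 : d ⬝ᵥ h = 0 := by rw [← hmean, hh, hf]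
  have h1 : h - K *ᵥ h = f := by
    have := hΦ h
    rw [hh, h0] at this
    rw [this]
    ext s
    simp
  exact ⟨h, h1, h1 ▸ hbound h h0⟩

end MarkovChain

/-! ### Average reward and stationary distributions of ergodic decision processes -/

namespace MDP

open Matrix Filter Topology

variable {S A : Type*} [Fintype S] [Fintype A] (M : MDP S A)

/-- The expected one-step reward `∑ₐ π(a | s) r(s, a)`. -/
noncomputable def meanReward (π : Policy S A) (s : S) : ℝ := ∑ a, π s a * M.r s a

lemma nonempty_state (M : MDP S A) : Nonempty S := by
  by_contra h
  rw [not_nonempty_iff] at h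
  have := stdSimplex.sum_eq_one M.ρ
  simp at this

lemma meanReward_mem_Icc (π : Policy S A) (s : S) : M.meanReward π s ∈ Set.Icc (0 : ℝ) 1 := by
  refine ⟨Finset.sum_nonneg fun a _ => mul_nonneg (stdSimplex.zero_le _ _) (M.r_mem s a).1, ?_⟩
  calc M.meanReward π s ≤ ∑ a, π s a * 1 := Finset.sum_le_sum fun a _ =>
        mul_le_mul_of_nonneg_left (M.r_mem s a).2 (stdSimplex.zero_le _ _)
    _ = 1 := by simp

lemma sum_transition (π : Policy S A) (f : S → ℝ) (s : S) :
    ∑ a, π s a * ∑ s', M.P s a s' * f s' = ∑ s', M.transition π s s' * f s' := by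
  simp only [transition, of_apply, Finset.sum_mul, Finset.mul_sum]
  rw [Finset.sum_comm]
  exact Finset.sum_congr rfl fun _ _ => Finset.sum_congr rfl fun _ _ => by ring

/-! #### Trajectories -/

lemma trajProb_snoc (π : Policy S A) (n : ℕ) (τ : Fin (n + 1) → S × A) (x : S × A) :
    M.trajProb π (n + 1) (Fin.snoc (α := fun _ => S × A) τ x) =
      M.trajProb π n τ * (π x.1 x.2 * M.P (τ (Fin.last n)).1 (τ (Fin.last n)).2 x.1) := by
  have h0 : Fin.snoc (α := fun _ => S × A) τ x 0 = τ 0 :=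
    Fin.snoc_castSucc (α := fun _ => S × A) x τ 0
  have hs : ∀ t : Fin n, Fin.snoc (α := fun _ => S × A) τ x t.castSucc.succ = τ t.succ := by
    intro t
    rw [Fin.succ_castSucc]
    exact Fin.snoc_castSucc (α := fun _ => S × A) x τ t.succ
  have hP : ∏ t : Fin (n + 1), M.P (Fin.snoc (α := fun _ => S × A) τ x t.castSucc).1
      (Fin.snoc (α := fun _ => S × A) τ x t.castSucc).2
      (Fin.snoc (α := fun _ => S × A) τ x t.succ).1 =
      (∏ t : Fin n, M.P (τ t.castSucc).1 (τ t.castSucc).2 (τ t.succ).1) *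
        M.P (τ (Fin.last n)).1 (τ (Fin.last n)).2 x.1 := by
    rw [Fin.prod_univ_castSucc]
    simp only [Fin.snoc_castSucc, Fin.snoc_last, hs, Fin.succ_last]
  unfold trajProb
  rw [h0, hP, Fin.prod_univ_castSucc]
  simp only [Fin.snoc_castSucc, Fin.snoc_last]
  ring

lemma sum_snoc {α : Type*} [Fintype α] {n : ℕ} (F : (Fin (n + 1) → α) → ℝ) :
    ∑ τ, F τ = ∑ τ : Fin n → α, ∑ x, F (Fin.snoc (α := fun _ => α) τ x) := by
  rw [← (Fin.snocEquiv fun _ => α).sum_comp, Fintype.sum_prod_type, Finset.sum_comm]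
  rfl

variable [DecidableEq S]

lemma transition_mem_rowStochastic (π : Policy S A) : M.transition π ∈ rowStochastic ℝ S := by
  refine mem_rowStochastic_iff_sum.2 ⟨fun s s' => Finset.sum_nonneg fun a _ =>
    mul_nonneg (stdSimplex.zero_le _ _) (stdSimplex.zero_le _ _), fun s => ?_⟩
  have := M.sum_transition π (fun _ => 1) s
  simpa using this.symm

/-- The Markov property: integrating out the last pair replaces `g` by its one-step conditional
expectation, so the induction must be over all `g`. -/
lemma sum_trajProb_mul_last (π : Policy S A) (n : ℕ) (g : S × A → ℝ) :
    ∑ τ, M.trajProb π n τ * g (τ (Fin.last n)) =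
      M.ρ ⬝ᵥ ((M.transition π ^ n) *ᵥ fun s => ∑ a, π s a * g (s, a)) := by
  induction n generalizing g with
  | zero =>
    rw [← (Equiv.funUnique (Fin 1) (S × A)).symm.sum_comp, Fintype.sum_prod_type]
    simp [trajProb, dotProduct, Finset.mul_sum, mul_assoc]
  | succ n ih =>
    have h : ∀ τ : Fin (n + 1) → S × A, ∑ x, M.trajProb π (n + 1)
          (Fin.snoc (α := fun _ => S × A) τ x) *
            g (Fin.snoc (α := fun _ => S × A) τ x (Fin.last (n + 1))) =
        M.trajProb π n τ * (fun y : S × A => ∑ s', M.P y.1 y.2 s' * ∑ a, π s' a * g (s', a))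
          (τ (Fin.last n)) := by
      intro τ
      simp only [trajProb_snoc, Fin.snoc_last, Fintype.sum_prod_type, Finset.mul_sum]
      exact Finset.sum_congr rfl fun _ _ => Finset.sum_congr rfl fun _ _ => by ring
    rw [sum_snoc, Finset.sum_congr rfl fun τ _ => h τ]
    refine (ih fun y => ∑ s', M.P y.1 y.2 s' * ∑ a, π s' a * g (s', a)).trans ?_
    rw [pow_succ, ← mulVec_mulVec]
    congr 2
    ext s
    exact M.sum_transition π _ s

lemma expReward_eq_sum (π : Policy S A) (n : ℕ) :
    M.expReward π n = ∑ t ∈ Finset.range (n + 1),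
      M.ρ ⬝ᵥ ((M.transition π ^ t) *ᵥ M.meanReward π) := by
  have hlast : ∀ n, ∑ τ, M.trajProb π n τ * M.r (τ (Fin.last n)).1 (τ (Fin.last n)).2 =
      M.ρ ⬝ᵥ ((M.transition π ^ n) *ᵥ M.meanReward π) := fun n =>
    M.sum_trajProb_mul_last π n fun x => M.r x.1 x.2
  induction n with
  | zero =>
    rw [zero_add, Finset.sum_range_one, ← hlast]
    simp [expReward]
  | succ n ih =>
    rw [Finset.sum_range_succ, ← ih, ← hlast]
    unfold expReward
    simp only [Fin.sum_univ_castSucc (n := n + 1), mul_add, Finset.sum_add_distrib]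
    congr 1
    rw [sum_snoc]
    refine Finset.sum_congr rfl fun τ _ => ?_
    have hone : ∑ x : S × A, π x.1 x.2 * M.P (τ (Fin.last n)).1 (τ (Fin.last n)).2 x.1 = 1 := by
      rw [Fintype.sum_prod_type]
      simp [← Finset.sum_mul]
    simp only [trajProb_snoc, Fin.snoc_castSucc, ← Finset.sum_mul, ← Finset.mul_sum, hone, mul_one]

/-! #### Ergodic processes -/

variable {M}

namespace IsErgodic

lemma exists_pow_pos (hM : M.IsErgodic) (π : Policy S A) :
    ∃ N > 0, ∀ s s', 0 < (M.transition π ^ N) s s' :=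
  exists_pow_pos_of_irreducible_of_aperiodic (hM π).1 (hM π).2

end IsErgodic

/-- Existence suffices to specify the `epsilon` choice; the later arguments use stationarity only,
not uniqueness. -/
lemma isStationaryDist_statDist (M : MDP S A) (π : Policy S A) :
    IsStationaryDist (M.transition π) (M.statDist π) :=
  have := M.nonempty_state
  Classical.epsilon_spec (exists_isStationaryDist (M.transition_mem_rowStochastic π))

namespace IsErgodic

lemma statDist_pos (hM : M.IsErgodic) (π : Policy S A) (s : S) : 0 < M.statDist π s := by
  obtain ⟨N, -, hN⟩ := hM.exists_pow_pos π
  exact (M.isStationaryDist_statDist π).pos hN s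

/-- The strict inequality, summed over all starting states, is an open condition on the policy; the
compactness argument for mixing times relies on this. -/
lemma exists_sum_abs_sub_lt (hM : M.IsErgodic) (π : Policy S A) :
    ∃ t, 1 ≤ t ∧ ∑ s, ∑ s', |(M.transition π ^ t) s s' - M.statDist π s'| < 1 / 4 := by
  have := M.nonempty_state
  obtain ⟨N, hN0, hN⟩ := hM.exists_pow_pos π
  exact exists_pow_sub_stationary_lt (M.transition_mem_rowStochastic π)
    (M.isStationaryDist_statDist π) hN0 hN (by norm_num)

end IsErgodic

lemma mixTime_le {π : Policy S A} {t : ℕ} (ht : 1 ≤ t)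
    (h : ∑ s, ∑ s', |(M.transition π ^ t) s s' - M.statDist π s'| < 1 / 4) :
    M.mixTime π ≤ t :=
  Nat.sInf_le ⟨ht, fun s => (Finset.single_le_sum
    (f := fun s => ∑ s', |(M.transition π ^ t) s s' - M.statDist π s'|)
    (fun _ _ => Finset.sum_nonneg fun _ _ => abs_nonneg _) (Finset.mem_univ s)).trans h.le⟩

namespace IsErgodic

lemma mixTime_spec (hM : M.IsErgodic) (π : Policy S A) :
    1 ≤ M.mixTime π ∧
      ∀ s, ∑ s', |(M.transition π ^ M.mixTime π) s s' - M.statDist π s'| ≤ 1 / 4 := by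
  obtain ⟨t, ht, h⟩ := hM.exists_sum_abs_sub_lt π
  exact Nat.sInf_mem (s := {t : ℕ | 1 ≤ t ∧
    ∀ s, ∑ s', |(M.transition π ^ t) s s' - M.statDist π s'| ≤ 1 / 4}) ⟨t, ht, fun s =>
    (Finset.single_le_sum
      (f := fun s => ∑ s', |(M.transition π ^ t) s s' - M.statDist π s'|)
      (fun _ _ => Finset.sum_nonneg fun _ _ => abs_nonneg _) (Finset.mem_univ s)).trans h.le⟩

/-- The relative value function: a bounded solution of the Poisson equation for `f`. -/
lemma exists_poisson (hM : M.IsErgodic) (π : Policy S A) (f : S → ℝ) :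
    ∃ h : S → ℝ, (∀ s, h s - (M.transition π *ᵥ h) s = f s - M.statDist π ⬝ᵥ f) ∧
      ‖h‖ ≤ 4 / 3 * M.mixTime π * ‖fun s => f s - M.statDist π ⬝ᵥ f‖ := by
  have hd := M.isStationaryDist_statDist π
  obtain ⟨h, h1, h2⟩ := exists_poisson_solution (M.transition_mem_rowStochastic π) hd
    (hM.mixTime_spec π).2 (hd.dotProduct_sub_const f)
  exact ⟨h, fun s => congrFun h1 s, h2⟩

/-- The average reward is the stationary expectation of the one-step reward. -/
lemma tendsto_expReward (hM : M.IsErgodic) (π : Policy S A) :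
    Tendsto (fun n : ℕ => M.expReward π n / ((n : ℝ) + 1)) atTop
      (𝓝 (M.statDist π ⬝ᵥ M.meanReward π)) := by
  set J := M.statDist π ⬝ᵥ M.meanReward π
  set K := M.transition π
  have hK : K ∈ rowStochastic ℝ S := M.transition_mem_rowStochastic π
  obtain ⟨h, hh, -⟩ := hM.exists_poisson π (M.meanReward π)
  have hρ : ∀ f : S → ℝ, |M.ρ ⬝ᵥ f| ≤ ‖f‖ := fun f =>
    abs_sum_mul_le_of_mem_stdSimplex M.ρ.2 fun s => norm_le_pi_norm f s
  have hconst : ∀ t, (K ^ t) *ᵥ (fun _ : S => J) = fun _ => J := fun t => by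
    ext x
    simp [mulVec, dotProduct, ← Finset.sum_mul, sum_row_of_mem_rowStochastic (pow_mem hK t)]
  have hρconst : (M.ρ ⬝ᵥ fun _ : S => J) = J := by
    simp [dotProduct, ← Finset.sum_mul]
  have hr : M.meanReward π = (h - K *ᵥ h) + fun _ => J := by
    ext s
    have := hh s
    simp only [Pi.add_apply, Pi.sub_apply]
    linarith
  have hexp : ∀ n : ℕ, M.expReward π n =
      M.ρ ⬝ᵥ (h - (K ^ (n + 1)) *ᵥ h) + ((n : ℝ) + 1) * J := by
    intro n
    rw [expReward_eq_sum]
    change ∑ t ∈ Finset.range (n + 1), M.ρ ⬝ᵥ ((K ^ t) *ᵥ M.meanReward π) = _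
    rw [hr]
    simp only [mulVec_add, dotProduct_add, hconst, hρconst, Finset.sum_add_distrib]
    rw [← dotProduct_sum, sum_pow_mulVec_sub]
    simp
  have hzero : Tendsto (fun n : ℕ => M.expReward π n / ((n : ℝ) + 1) - J) atTop (𝓝 0) := by
    have hlim : Tendsto (fun n : ℕ => 2 * ‖h‖ * (1 / ((n : ℝ) + 1))) atTop (𝓝 0) := by
      simpa using tendsto_one_div_add_atTop_nhds_zero_nat.const_mul (2 * ‖h‖)
    refine squeeze_zero_norm (fun n => ?_) hlim
    have hn : (0 : ℝ) < (n : ℝ) + 1 := by positivity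
    have heq : M.expReward π n / ((n : ℝ) + 1) - J =
        M.ρ ⬝ᵥ (h - (K ^ (n + 1)) *ᵥ h) * (1 / ((n : ℝ) + 1)) := by
      rw [hexp]
      field_simp
      ring
    rw [heq, Real.norm_eq_abs, abs_mul, abs_of_pos (one_div_pos.2 hn)]
    refine mul_le_mul_of_nonneg_right ((hρ _).trans ?_) (one_div_pos.2 hn).le
    have := norm_mulVec_le_of_mem_rowStochastic (pow_mem hK (n + 1)) h
    linarith [norm_sub_le h ((K ^ (n + 1)) *ᵥ h)]
  simpa using hzero.add_const J

lemma avgReward_eq (hM : M.IsErgodic) (π : Policy S A) :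
    M.avgReward π = M.statDist π ⬝ᵥ M.meanReward π :=
  (hM.tendsto_expReward π).limUnder_eq

end IsErgodic

end MDP

/-! ### Perturbation of the policy -/

namespace MDP

open Matrix Filter Topology

variable {S A : Type*} [Fintype A]

lemma continuous_policy_apply (s : S) (a : A) : Continuous fun π : Policy S A => π s a :=
  (continuous_apply a).comp (continuous_subtype_val.comp (continuous_apply s))

lemma abs_sum_mul_le_mul {x c : A → ℝ} {κ b : ℝ} (hx : ∑ a, |x a| ≤ κ) (hb : 0 ≤ b)
    (hc : ∀ a, |c a| ≤ b) : |∑ a, x a * c a| ≤ κ * b :=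
  calc |∑ a, x a * c a| ≤ ∑ a, |x a * c a| := Finset.abs_sum_le_sum_abs _ _
    _ ≤ ∑ a, |x a| * b := Finset.sum_le_sum fun a _ => by
        rw [abs_mul]
        exact mul_le_mul_of_nonneg_left (hc a) (abs_nonneg _)
    _ ≤ κ * b := by
        rw [← Finset.sum_mul]
        exact mul_le_mul_of_nonneg_right hx hb

variable [Fintype S] {M : MDP S A}

lemma transition_mulVec_sub (π π' : Policy S A) (f : S → ℝ) (s : S) :
    (M.transition π' *ᵥ f) s - (M.transition π *ᵥ f) s =
      ∑ a, (π' s a - π s a) * ∑ s', M.P s a s' * f s' := by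
  simp only [sub_mul, Finset.sum_sub_distrib, sum_transition]
  rfl

lemma abs_sum_P_mul_le (s : S) (a : A) (f : S → ℝ) : |∑ s', M.P s a s' * f s'| ≤ ‖f‖ :=
  abs_sum_mul_le_of_mem_stdSimplex (M.P s a).2 fun s' => norm_le_pi_norm f s'

variable [DecidableEq S]

namespace IsErgodic

/-- Lipschitz dependence of the stationary distribution on the policy. -/
lemma abs_statDist_dotProduct_sub_le (hM : M.IsErgodic) {π π' : Policy S A} {κ : ℝ}
    (hκ : ∀ s, ∑ a, |π' s a - π s a| ≤ κ) (f : S → ℝ) :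
    |M.statDist π' ⬝ᵥ f - M.statDist π ⬝ᵥ f| ≤ 8 / 3 * M.mixTime π * κ * ‖f‖ := by
  obtain ⟨s₀⟩ := M.nonempty_state
  have hκ0 : 0 ≤ κ := (Finset.sum_nonneg fun _ _ => abs_nonneg _).trans (hκ s₀)
  have hd := M.isStationaryDist_statDist π
  have hd' := M.isStationaryDist_statDist π'
  obtain ⟨h, hh, hnorm⟩ := hM.exists_poisson π f
  have hf2 : ‖fun s => f s - M.statDist π ⬝ᵥ f‖ ≤ 2 * ‖f‖ := by
    refine (pi_norm_le_iff_of_nonneg (by positivity)).2 fun s => ?_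
    have h1 := norm_le_pi_norm f s
    have h2 := hd.abs_dotProduct_le f
    calc ‖f s - M.statDist π ⬝ᵥ f‖ ≤ ‖f s‖ + ‖M.statDist π ⬝ᵥ f‖ := norm_sub_le _ _
      _ ≤ 2 * ‖f‖ := by rw [Real.norm_eq_abs (M.statDist π ⬝ᵥ f)]; linarith
  -- Test the Poisson equation for `π` against `d'`, and rewrite `d'·h` as `d'·K'h`.
  have hdiff : M.statDist π' ⬝ᵥ f - M.statDist π ⬝ᵥ f =
      M.statDist π' ⬝ᵥ (M.transition π' *ᵥ h - M.transition π *ᵥ h) := by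
    have hf : f = (h - M.transition π *ᵥ h) + fun _ => M.statDist π ⬝ᵥ f := by
      ext s
      have := hh s
      simp only [Pi.add_apply, Pi.sub_apply]
      linarith
    conv_lhs => rw [hf]
    rw [dotProduct_add, hd'.dotProduct_const, dotProduct_add, hd.dotProduct_const,
      dotProduct_sub, dotProduct_sub, dotProduct_sub, hd'.dotProduct_mulVec,
      hd.dotProduct_mulVec]
    ring
  rw [hdiff]
  refine (hd'.abs_dotProduct_le _).trans ?_
  have hle : ‖M.transition π' *ᵥ h - M.transition π *ᵥ h‖ ≤ κ * ‖h‖ := by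
    refine (pi_norm_le_iff_of_nonneg (by positivity)).2 fun s => ?_
    rw [Pi.sub_apply, transition_mulVec_sub, Real.norm_eq_abs]
    exact abs_sum_mul_le_mul (hκ s) (norm_nonneg h) fun a => abs_sum_P_mul_le s a h
  calc _ ≤ κ * ‖h‖ := hle
    _ ≤ κ * (4 / 3 * M.mixTime π * (2 * ‖f‖)) := by gcongr; exact hnorm.trans (by gcongr)
    _ = 8 / 3 * M.mixTime π * κ * ‖f‖ := by ring

/-- A bounded action-value function of `π`, together with the performance difference formula. -/
lemma exists_actionValue (hM : M.IsErgodic) (π : Policy S A) :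
    ∃ Q : S → A → ℝ, (∀ s a, |Q s a| ≤ 3 * M.mixTime π) ∧
      ∀ π' : Policy S A, M.avgReward π' - M.avgReward π =
        M.statDist π' ⬝ᵥ fun s => ∑ a, (π' s a - π s a) * Q s a := by
  have hd := M.isStationaryDist_statDist π
  have hm : (1 : ℝ) ≤ M.mixTime π := by exact_mod_cast (hM.mixTime_spec π).1
  obtain ⟨h, hh, hnorm⟩ := hM.exists_poisson π (M.meanReward π)
  set J := M.statDist π ⬝ᵥ M.meanReward π with hJ
  have hJ0 : 0 ≤ J := Finset.sum_nonneg fun s _ =>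
    mul_nonneg (hd.1.1 s) (M.meanReward_mem_Icc π s).1
  have hJ1 : J ≤ 1 := by
    rw [← hd.1.2]
    exact Finset.sum_le_sum fun s _ =>
      mul_le_of_le_one_right (hd.1.1 s) (M.meanReward_mem_Icc π s).2
  have hh1 : ‖h‖ ≤ 4 / 3 * M.mixTime π := by
    refine hnorm.trans (mul_le_of_le_one_right (by positivity) ?_)
    refine (pi_norm_le_iff_of_nonneg zero_le_one).2 fun s => abs_le.2 ?_
    have := M.meanReward_mem_Icc π s
    constructor <;> linarith [this.1, this.2]
  -- Size `1 + 4m/3 ≤ 3m`, as `m ≥ 1`. The Poisson equation says that `h` is the `π`-average of this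
  -- `Q`.
  refine ⟨fun s a => M.r s a - J + ∑ s', M.P s a s' * h s', fun s a => ?_, fun π' => ?_⟩
  · have h1 : |M.r s a - J| ≤ 1 := abs_le.2
      ⟨by linarith [(M.r_mem s a).1], by linarith [(M.r_mem s a).2]⟩
    have h2 := abs_sum_P_mul_le (M := M) s a h
    exact (abs_add_le _ _).trans (by linarith)
  · have hd' := M.isStationaryDist_statDist π'
    have hQ : (fun s => ∑ a, (π' s a - π s a) * (M.r s a - J + ∑ s', M.P s a s' * h s')) =
        M.meanReward π' - (fun _ => J) + (M.transition π' *ᵥ h - h) := by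
      ext s
      have e1 := transition_mulVec_sub (M := M) π π' h s
      have e2 := hh s
      have e3 : ∑ a, (π' s a - π s a) * J = 0 := by
        rw [← Finset.sum_mul, Finset.sum_sub_distrib]
        simp
      have e4 : ∑ a, (π' s a - π s a) * M.r s a = M.meanReward π' s - M.meanReward π s := by
        simp only [meanReward, sub_mul, Finset.sum_sub_distrib]
      simp only [mul_add, mul_sub, Finset.sum_add_distrib, Finset.sum_sub_distrib, Pi.add_apply,
        Pi.sub_apply] at e1 e3 e4 ⊢
      linarith
    rw [hQ, dotProduct_add, dotProduct_sub, dotProduct_sub, hd'.dotProduct_mulVec,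
      hd'.dotProduct_const, hM.avgReward_eq, hM.avgReward_eq]
    ring

/-! #### Uniform bounds over the compact set of policies -/

/-- The Lipschitz estimate involves the mixing time of the base policy alone, so continuity precedes
any uniform bound on mixing times. -/
lemma continuous_statDist (hM : M.IsErgodic) (s : S) :
    Continuous fun π : Policy S A => M.statDist π s := by
  refine continuous_iff_continuousAt.2 fun π => ?_
  have hκ : Continuous fun π' : Policy S A => ∑ s, ∑ a, |π' s a - π s a| :=
    continuous_finsetSum _ fun s _ => continuous_finsetSum _ fun a _ =>
      ((continuous_policy_apply s a).sub continuous_const).abs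
  have hlim : Tendsto (fun π' : Policy S A => 8 / 3 * M.mixTime π *
      (∑ s, ∑ a, |π' s a - π s a|) * ‖(Pi.single s 1 : S → ℝ)‖) (𝓝 π) (𝓝 0) := by
    have := ((hκ.const_mul (8 / 3 * (M.mixTime π : ℝ))).mul_const
      ‖(Pi.single s 1 : S → ℝ)‖).tendsto π
    simpa using this
  refine tendsto_iff_norm_sub_tendsto_zero.2
    (squeeze_zero (fun _ => norm_nonneg _) (fun π' => ?_) hlim)
  have := hM.abs_statDist_dotProduct_sub_le (π := π) (π' := π')
    (κ := ∑ s, ∑ a, |π' s a - π s a|)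
    (fun s => Finset.single_le_sum (f := fun s => ∑ a, |π' s a - π s a|)
      (fun _ _ => Finset.sum_nonneg fun _ _ => abs_nonneg _) (Finset.mem_univ s))
    (Pi.single s 1)
  simpa only [dotProduct_single_one, Real.norm_eq_abs] using this

/-- Finitely many of the open sets "time `t` suffices" cover the compact space of policies. Without
boundedness the supremum in `tMix` would take the default value 0. -/
lemma bddAbove_range_mixTime (hM : M.IsErgodic) :
    BddAbove (Set.range fun π : Policy S A => M.mixTime π) := by
  have hcont : ∀ t, Continuous fun π : Policy S A =>
      ∑ s, ∑ s', |(M.transition π ^ t) s s' - M.statDist π s'| := by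
    intro t
    have hK : Continuous fun π : Policy S A => M.transition π :=
      continuous_matrix fun s s' => continuous_finsetSum _ fun a _ =>
        continuous_const.mul (continuous_policy_apply s a)
    exact continuous_finsetSum _ fun s _ => continuous_finsetSum _ fun s' _ =>
      (((hK.pow t).matrix_elem s s').sub (hM.continuous_statDist s')).abs
  obtain ⟨F, hF⟩ := isCompact_univ.elim_finite_subcover
    (fun t : ℕ => {π : Policy S A | 1 ≤ t ∧
      ∑ s, ∑ s', |(M.transition π ^ t) s s' - M.statDist π s'| < 1 / 4})
    (fun t => isOpen_const.inter (isOpen_lt (hcont t) continuous_const))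
    (fun π _ => Set.mem_iUnion.2 (hM.exists_sum_abs_sub_lt π))
  refine ⟨F.sup id, ?_⟩
  rintro _ ⟨π, rfl⟩
  obtain ⟨t, ht, h1, h2⟩ := Set.mem_iUnion₂.1 (hF (Set.mem_univ π))
  exact (mixTime_le h1 h2).trans (Finset.le_sup (f := id) ht)

lemma bddAbove_range_hitTime (hM : M.IsErgodic) :
    BddAbove (Set.range fun π : Policy S A => M.hitTime π) := by
  have := M.nonempty_state
  have hbdd : ∀ s, ∃ b, ∀ π : Policy S A, 1 / M.statDist π s ≤ b := by
    intro s
    have hc : Continuous fun π : Policy S A => 1 / M.statDist π s :=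
      continuous_const.div (hM.continuous_statDist s) fun π => (hM.statDist_pos π s).ne'
    obtain ⟨b, hb⟩ := (isCompact_range hc).bddAbove
    exact ⟨b, fun π => hb ⟨π, rfl⟩⟩
  choose b hb using hbdd
  obtain ⟨s₀, hs₀⟩ := Finite.exists_max b
  exact ⟨b s₀, by rintro _ ⟨π, rfl⟩; exact ciSup_le fun s => (hb s π).trans (hs₀ s)⟩

lemma mixTime_le_tMix (hM : M.IsErgodic) {Θ : Type*} (π : Θ → Policy S A) (θ : Θ) :
    M.mixTime (π θ) ≤ M.tMix π :=
  le_ciSup (f := fun θ => M.mixTime (π θ))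
    (hM.bddAbove_range_mixTime.mono (by rintro _ ⟨θ, rfl⟩; exact ⟨π θ, rfl⟩)) θ

lemma one_le_hitTime (hM : M.IsErgodic) (π : Policy S A) : 1 ≤ M.hitTime π := by
  obtain ⟨s⟩ := M.nonempty_state
  have hd := M.isStationaryDist_statDist π
  have h1 : M.statDist π s ≤ 1 := by
    rw [← hd.1.2]
    exact Finset.single_le_sum (fun x _ => hd.1.1 x) (Finset.mem_univ s)
  exact ((one_le_div (hM.statDist_pos π s)).2 h1).trans
    (le_ciSup (f := fun s => 1 / M.statDist π s) (Set.finite_range _).bddAbove s)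

lemma one_le_tHit (hM : M.IsErgodic) {Θ : Type*} [Nonempty Θ] (π : Θ → Policy S A) :
    1 ≤ M.tHit π :=
  (hM.one_le_hitTime (π (Classical.arbitrary Θ))).trans
    (le_ciSup (f := fun θ => M.hitTime (π θ))
      (hM.bddAbove_range_hitTime.mono (by rintro _ ⟨θ, rfl⟩; exact ⟨π θ, rfl⟩)) _)

end IsErgodic

end MDP

/-! ### A criterion for differentiability -/

lemma hasGradientAt_of_abs_sub_le {E : Type*} [NormedAddCommGroup E] [InnerProductSpace ℝ E]
    [CompleteSpace E] {f : E → ℝ} {g x : E} {K : ℝ}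
    (h : ∀ y, |f y - f x - inner ℝ g (y - x)| ≤ K * ‖y - x‖ ^ 2) : HasGradientAt f g x := by
  rw [hasGradientAt_iff_isLittleO]
  have hO : (fun y => f y - f x - inner ℝ g (y - x)) =O[nhds x] fun y => ‖y - x‖ ^ 2 :=
    Asymptotics.IsBigO.of_bound K (Filter.Eventually.of_forall fun y => by
      simpa [abs_of_nonneg (sq_nonneg ‖y - x‖)] using h y)
  exact hO.trans_isLittleO (Asymptotics.isLittleO_pow_sub_sub x one_lt_two)

/-! ### First- and second-order bounds for the policy parametrization -/

namespace ScoreBounds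

variable {S A : Type*} [Fintype A] {d : ℕ} {π : EuclideanSpace ℝ (Fin d) → Policy S A} {G B : ℝ}

/-- The score `∇ log π_θ(a | s)`. -/
noncomputable abbrev score (π : EuclideanSpace ℝ (Fin d) → Policy S A) (s : S) (a : A) :
    EuclideanSpace ℝ (Fin d) → EuclideanSpace ℝ (Fin d) :=
  gradient fun θ => Real.log (π θ s a)

lemma abs_inner_score_le (hπ : ScoreBounds π G B) (θ v : EuclideanSpace ℝ (Fin d)) (s : S) (a : A) :
    |inner ℝ (score π s a θ) v| ≤ G * ‖v‖ :=
  (abs_real_inner_le_norm _ _).trans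
    (mul_le_mul_of_nonneg_right (hπ.score_le θ s a) (norm_nonneg v))

lemma abs_inner_hessian_le (hπ : ScoreBounds π G B) (θ v : EuclideanSpace ℝ (Fin d)) (s : S)
    (a : A) : |inner ℝ (fderiv ℝ (score π s a) θ v) v| ≤ B * ‖v‖ ^ 2 := by
  refine (abs_real_inner_le_norm _ _).trans ?_
  rw [sq, ← mul_assoc]
  exact mul_le_mul_of_nonneg_right (((fderiv ℝ (score π s a) θ).le_opNorm v).trans
    (mul_le_mul_of_nonneg_right (hπ.hessian_le θ s a) (norm_nonneg v))) (norm_nonneg v)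

lemma hasDerivAt_line (θ v : EuclideanSpace ℝ (Fin d)) (u : ℝ) :
    HasDerivAt (fun u : ℝ => θ + u • v) v u := by
  simpa using ((hasDerivAt_id u).smul_const v).const_add θ

/-- Only the logarithm is assumed differentiable; positivity permits writing the probability as its
exponential. -/
lemma hasDerivAt_prob_line (hπ : ScoreBounds π G B) (θ v : EuclideanSpace ℝ (Fin d)) (s : S)
    (a : A) (u : ℝ) :
    HasDerivAt (fun u : ℝ => π (θ + u • v) s a)
      (π (θ + u • v) s a * inner ℝ (score π s a (θ + u • v)) v) u := by
  have hlog : HasDerivAt (fun u : ℝ => Real.log (π (θ + u • v) s a))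
      (inner ℝ (score π s a (θ + u • v)) v) u := by
    rw [inner_gradient_left]
    exact (hπ.diff_log s a (θ + u • v)).hasFDerivAt.comp_hasDerivAt u (hasDerivAt_line θ v u)
  have hexp := hlog.exp
  simpa only [Real.exp_log (hπ.pos _ s a)] using hexp

lemma hasDerivAt_score_line (hπ : ScoreBounds π G B) (θ v : EuclideanSpace ℝ (Fin d)) (s : S)
    (a : A) (u : ℝ) :
    HasDerivAt (fun u : ℝ => inner ℝ (score π s a (θ + u • v)) v)
      (inner ℝ (fderiv ℝ (score π s a) (θ + u • v) v) v) u := by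
  have h := (hπ.diff_score s a (θ + u • v)).hasFDerivAt.comp_hasDerivAt u (hasDerivAt_line θ v u)
  simpa using h.inner ℝ (hasDerivAt_const u v)

lemma abs_sum_prob_mul_le (θ : EuclideanSpace ℝ (Fin d)) (s : S) {x : A → ℝ} {b : ℝ}
    (hx : ∀ a, |x a| ≤ b) : |∑ a, π θ s a * x a| ≤ b :=
  abs_sum_mul_le_of_mem_stdSimplex (π θ s).2 hx

lemma nonempty_action [Nonempty S] (_ : ScoreBounds π G B) : Nonempty A := by
  by_contra h
  rw [not_nonempty_iff] at h
  have := stdSimplex.sum_eq_one (π 0 (Classical.arbitrary S))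
  simp at this

lemma score_bound_nonneg [Nonempty S] [Nonempty A] (hπ : ScoreBounds π G B) : 0 ≤ G :=
  (norm_nonneg _).trans (hπ.score_le 0 (Classical.arbitrary S) (Classical.arbitrary A))

lemma hessian_bound_nonneg [Nonempty S] [Nonempty A] (hπ : ScoreBounds π G B) : 0 ≤ B :=
  (norm_nonneg _).trans (hπ.hessian_le 0 (Classical.arbitrary S) (Classical.arbitrary A))

lemma abs_sum_prob_mul_inner_score_mul_le (hπ : ScoreBounds π G B)
    (θ v : EuclideanSpace ℝ (Fin d)) (s : S) {c : A → ℝ} {b : ℝ} (hc : ∀ a, |c a| ≤ b) :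
    |∑ a, π θ s a * inner ℝ (score π s a θ) v * c a| ≤ G * ‖v‖ * b := by
  simp only [mul_assoc]
  refine abs_sum_prob_mul_le θ s fun a => ?_
  rw [abs_mul, ← mul_assoc]
  exact mul_le_mul (hπ.abs_inner_score_le θ v s a) (hc a) (abs_nonneg _)
    ((abs_nonneg _).trans (hπ.abs_inner_score_le θ v s a))

lemma hasDerivAt_sum_prob_line (hπ : ScoreBounds π G B) (θ v : EuclideanSpace ℝ (Fin d)) (s : S)
    (c : A → ℝ) (u : ℝ) :
    HasDerivAt (fun u : ℝ => ∑ a, π (θ + u • v) s a * c a)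
      (∑ a, π (θ + u • v) s a * inner ℝ (score π s a (θ + u • v)) v * c a) u :=
  HasDerivAt.fun_sum fun a _ => (hπ.hasDerivAt_prob_line θ v s a u).mul_const (c a)

/-- The `ℓ¹` distance of the action distributions is Lipschitz in the parameter. -/
lemma sum_abs_sub_le (hπ : ScoreBounds π G B) (θ θ' : EuclideanSpace ℝ (Fin d)) (s : S) :
    ∑ a, |π θ' s a - π θ s a| ≤ G * ‖θ' - θ‖ := by
  -- Duality: frozen signs turn the `ℓ¹` distance into a function that is differentiable along the
  -- segment.
  set c : A → ℝ := fun a => SignType.sign (π θ' s a - π θ s a)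
  have hc : ∀ a, |c a| ≤ 1 := fun a => by
    rcases lt_trichotomy (π θ' s a - π θ s a) 0 with h | h | h <;> simp [c, h]
  have h := norm_image_sub_le_of_norm_deriv_le_segment_01'
    (fun u _ => (hπ.hasDerivAt_sum_prob_line θ (θ' - θ) s c u).hasDerivWithinAt)
    (fun u _ => hπ.abs_sum_prob_mul_inner_score_mul_le (θ + u • (θ' - θ)) (θ' - θ) s hc)
  simp only [one_smul, add_sub_cancel, zero_smul, add_zero, mul_one] at h
  refine le_of_eq_of_le ?_ ((le_abs_self _).trans h)
  rw [← Finset.sum_sub_distrib]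
  refine Finset.sum_congr rfl fun a _ => ?_
  rw [← sub_mul, mul_comm, sign_mul_self]

/-- The first-order Taylor remainder of the action probabilities. -/
lemma abs_sum_taylor_remainder_le (hπ : ScoreBounds π G B) (θ θ' : EuclideanSpace ℝ (Fin d))
    (s : S) {c : A → ℝ} {b : ℝ} (hc : ∀ a, |c a| ≤ b) :
    |∑ a, (π θ' s a - π θ s a) * c a - ∑ a, π θ s a * inner ℝ (score π s a θ) (θ' - θ) * c a| ≤
      (G ^ 2 + B) * ‖θ' - θ‖ ^ 2 * b := by
  set v := θ' - θ with hv
  let D : ℝ → ℝ := fun u => ∑ a, π (θ + u • v) s a * inner ℝ (score π s a (θ + u • v)) v * c a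
  let D' : ℝ → ℝ := fun u => ∑ a, π (θ + u • v) s a *
    ((inner ℝ (score π s a (θ + u • v)) v ^ 2 +
      inner ℝ (fderiv ℝ (score π s a) (θ + u • v) v) v) * c a)
  have hD : ∀ u, HasDerivAt D (D' u) u := by
    intro u
    refine (HasDerivAt.fun_sum fun a _ => (((hπ.hasDerivAt_prob_line θ v s a u).mul
      (hπ.hasDerivAt_score_line θ v s a u)).mul_const (c a))).congr_deriv ?_
    exact Finset.sum_congr rfl fun a _ => by ring
  have hD' : ∀ u, ‖D' u‖ ≤ (G ^ 2 + B) * ‖v‖ ^ 2 * b := by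
    intro u
    refine abs_sum_prob_mul_le _ s fun a => ?_
    have h1 := hπ.abs_inner_score_le (θ + u • v) v s a
    have h2 := hπ.abs_inner_hessian_le (θ + u • v) v s a
    have h3 : |inner ℝ (score π s a (θ + u • v)) v ^ 2 +
        inner ℝ (fderiv ℝ (score π s a) (θ + u • v) v) v| ≤ (G ^ 2 + B) * ‖v‖ ^ 2 := by
      refine (abs_add_le _ _).trans ?_
      rw [abs_pow]
      have := pow_le_pow_left₀ (abs_nonneg _) h1 2
      nlinarith
    rw [abs_mul]
    exact mul_le_mul h3 (hc a) (abs_nonneg _) ((abs_nonneg _).trans h3)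
  have hstep : ∀ u ∈ Set.Ico (0 : ℝ) 1, ‖D u - D 0‖ ≤ (G ^ 2 + B) * ‖v‖ ^ 2 * b := by
    intro u hu
    have h0 : 0 ≤ (G ^ 2 + B) * ‖v‖ ^ 2 * b := (norm_nonneg _).trans (hD' 0)
    have := norm_image_sub_le_of_norm_deriv_le_segment' (f := D) (f' := D') (a := 0) (b := u)
      (fun x _ => (hD x).hasDerivWithinAt) (fun x _ => hD' x) u ⟨hu.1, le_rfl⟩
    refine this.trans (mul_le_of_le_one_right h0 ?_)
    linarith [hu.2]
  -- A second use of the mean value inequality, now for the sum minus `u * D 0`. It requires no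
  -- continuity of the Hessian, at the price of the Taylor factor `1/2`.
  have h := norm_image_sub_le_of_norm_deriv_le_segment_01'
    (fun u _ => ((hπ.hasDerivAt_sum_prob_line θ v s c u).sub
      ((hasDerivAt_id u).mul_const (D 0))).hasDerivWithinAt)
    (fun u hu => by simpa only [one_mul] using hstep u hu)
  have hD0 : D 0 = ∑ a, π θ s a * inner ℝ (score π s a θ) v * c a := by simp [D]
  rw [← hD0]
  refine le_of_eq_of_le ?_ h
  simp only [Pi.sub_apply, one_smul, hv, add_sub_cancel, zero_smul, add_zero, id, one_mul,
    zero_mul, sub_zero, sub_mul, Finset.sum_sub_distrib, Real.norm_eq_abs]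
  congr 1
  ring

end ScoreBounds

/-! ### Smoothness of the average reward -/

namespace MDP.IsErgodic

open ScoreBounds Matrix

variable {S A : Type*} [Fintype S] [DecidableEq S] [Fintype A] {M : MDP S A} {d : ℕ}
  {π : EuclideanSpace ℝ (Fin d) → Policy S A} {G B : ℝ}

/-- The policy gradient, with Lipschitz and second-order bounds for the average reward. -/
lemma exists_gradient_bounds (hM : M.IsErgodic) (hπ : ScoreBounds π G B)
    (θ : EuclideanSpace ℝ (Fin d)) :
    ∃ g : EuclideanSpace ℝ (Fin d),
      (∀ v, |inner ℝ g v| ≤ 3 * M.tMix π * G * ‖v‖) ∧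
      ∀ θ', |M.avgReward (π θ') - M.avgReward (π θ)| ≤ 3 * M.tMix π * G * ‖θ' - θ‖ ∧
        |M.avgReward (π θ') - M.avgReward (π θ) - inner ℝ g (θ' - θ)| ≤
          (11 * (M.tMix π : ℝ) ^ 2 * G ^ 2 + 3 * M.tMix π * B) * ‖θ' - θ‖ ^ 2 := by
  have := M.nonempty_state
  have := hπ.nonempty_action
  have hG := hπ.score_bound_nonneg
  have hB := hπ.hessian_bound_nonneg
  obtain ⟨Q, hQ, hdiff⟩ := hM.exists_actionValue (π θ)
  have hmm : (M.mixTime (π θ) : ℝ) ≤ M.tMix π := by exact_mod_cast hM.mixTime_le_tMix π θ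
  have hm1 : (1 : ℝ) ≤ M.mixTime (π θ) := by exact_mod_cast (hM.mixTime_spec (π θ)).1
  set m : ℝ := (M.tMix π : ℝ)
  have hm : 1 ≤ m := hm1.trans hmm
  have hQm : ∀ s a, |Q s a| ≤ 3 * m := fun s a => (hQ s a).trans (by linarith)
  let F : EuclideanSpace ℝ (Fin d) → S → ℝ := fun v s =>
    ∑ a, π θ s a * inner ℝ (score π s a θ) v * Q s a
  have hF : ∀ v, ‖F v‖ ≤ 3 * m * G * ‖v‖ := fun v =>
    (pi_norm_le_iff_of_nonneg (by positivity)).2 fun s =>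
      (hπ.abs_sum_prob_mul_inner_score_mul_le θ v s (hQm s)).trans_eq (by ring)
  let g : EuclideanSpace ℝ (Fin d) :=
    ∑ s, ∑ a, (M.statDist (π θ) s * (π θ s a * Q s a)) • score π s a θ
  have hg : ∀ v, inner ℝ g v = M.statDist (π θ) ⬝ᵥ F v := by
    intro v
    simp only [g, F, sum_inner, real_inner_smul_left, dotProduct, Finset.mul_sum]
    exact Finset.sum_congr rfl fun _ _ => Finset.sum_congr rfl fun _ _ => by ring
  refine ⟨g, fun v => ?_, fun θ' => ⟨?_, ?_⟩⟩
  · rw [hg]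
    exact ((M.isStationaryDist_statDist _).abs_dotProduct_le _).trans (hF v)
  · rw [hdiff]
    refine abs_sum_mul_le_of_mem_stdSimplex (M.isStationaryDist_statDist _).1 fun s => ?_
    exact (abs_sum_mul_le_mul (hπ.sum_abs_sub_le θ θ' s) (by positivity) (hQm s)).trans_eq
      (by ring)
  · have h1 : |M.statDist (π θ') ⬝ᵥ ((fun s => ∑ a, (π θ' s a - π θ s a) * Q s a) -
        F (θ' - θ))| ≤ (G ^ 2 + B) * ‖θ' - θ‖ ^ 2 * (3 * m) :=
      abs_sum_mul_le_of_mem_stdSimplex (M.isStationaryDist_statDist _).1 fun s =>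
        hπ.abs_sum_taylor_remainder_le θ θ' s (hQm s)
    have h2 : |M.statDist (π θ') ⬝ᵥ F (θ' - θ) - M.statDist (π θ) ⬝ᵥ F (θ' - θ)| ≤
        8 / 3 * m * (G * ‖θ' - θ‖) * (3 * m * G * ‖θ' - θ‖) := by
      refine (hM.abs_statDist_dotProduct_sub_le (hπ.sum_abs_sub_le θ θ') _).trans ?_
      gcongr
      exact hF _
    have h3 : M.avgReward (π θ') - M.avgReward (π θ) - inner ℝ g (θ' - θ) =
        M.statDist (π θ') ⬝ᵥ ((fun s => ∑ a, (π θ' s a - π θ s a) * Q s a) - F (θ' - θ)) +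
        (M.statDist (π θ') ⬝ᵥ F (θ' - θ) - M.statDist (π θ) ⬝ᵥ F (θ' - θ)) := by
      rw [hg, hdiff, dotProduct_sub]
      ring
    rw [h3]
    refine (abs_add_le _ _).trans ((add_le_add h1 h2).trans ?_)
    -- With `3m ≤ 3m²` the coefficient of `G²` becomes `3 + 8 = 11` times `m²`.
    have h4 : G ^ 2 * ‖θ' - θ‖ ^ 2 * m ≤ G ^ 2 * ‖θ' - θ‖ ^ 2 * m ^ 2 := by
      gcongr
      nlinarith
    nlinarith

end MDP.IsErgodic

theorem theorem3 :
    ∃ C : ℝ, 0 < C ∧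
      ∀ (S A : Type*) [Fintype S] [DecidableEq S] [Fintype A] (M : MDP S A) (d : ℕ)
        (π : EuclideanSpace ℝ (Fin d) → Policy S A) (G B : ℝ),
        M.IsErgodic → ScoreBounds π G B →
        Differentiable ℝ (fun θ => M.avgReward (π θ)) ∧
        ∀ T : ℕ, 1 ≤ T →
          ∃ L : ℝ, 0 ≤ L ∧
            L ≤ C * (√(Fintype.card A) * G ^ 2 * (M.tMix π : ℝ) ^ 2 * M.tHit π * Real.log T ^ 3
              + B * M.tMix π * Real.log T) ∧
            ∀ θ₀ θ θ' : EuclideanSpace ℝ (Fin d),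
              ∃ Δ : ℝ, 0 ≤ Δ ∧
                Δ ≤ C * (Fintype.card A * G * M.tMix π * (‖θ - θ₀‖ + ‖θ' - θ₀‖) / (T : ℝ) ^ 4) ∧
                M.optReward - M.avgReward (π θ') ≤
                  M.optReward - M.avgReward (π θ)
                    - inner ℝ (gradient (fun ϑ => M.avgReward (π ϑ)) θ) (θ' - θ)
                    + L / 2 * ‖θ' - θ‖ ^ 2 + Δ := by
  -- The tightest demand on the constant is `22 ≤ 100 · 3/10`, where `3/10` bounds `(log 2)³` from
  -- below.
  refine ⟨100, by norm_num, ?_⟩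
  intro S A _ _ _ M d π G B hM hπ
  have hS := M.nonempty_state
  have hA : Nonempty A := hπ.nonempty_action
  have hG := hπ.score_bound_nonneg
  have hB := hπ.hessian_bound_nonneg
  choose g hg hbound using fun θ => hM.exists_gradient_bounds hπ θ
  have hgrad : ∀ θ, HasGradientAt (fun ϑ => M.avgReward (π ϑ)) (g θ) θ := fun θ =>
    hasGradientAt_of_abs_sub_le fun θ' => (hbound θ θ').2
  have hA1 : (1 : ℝ) ≤ Fintype.card A := by exact_mod_cast Fintype.card_pos
  have hhit : 1 ≤ M.tHit π := hM.one_le_tHit π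
  refine ⟨fun θ => (hgrad θ).differentiableAt, fun T hT => ?_⟩
  set m : ℝ := (M.tMix π : ℝ)
  have hm : 0 ≤ m := Nat.cast_nonneg _
  -- At `T = 1` the increment of `J` and its linear part are each at most `3mG‖θ' - θ‖`, and the
  -- triangle inequality through `θ₀` fits both into `Δ`.
  obtain rfl | hT2 : T = 1 ∨ 2 ≤ T := by omega
  · refine ⟨0, le_rfl, by simp, fun θ₀ θ θ' => ⟨_, ?_, le_rfl, ?_⟩⟩
    · positivity
    · rw [(hgrad θ).gradient]
      have h1 := abs_le.1 (hg θ (θ' - θ))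
      have h2 := abs_le.1 (hbound θ θ').1
      have h3 : ‖θ' - θ‖ ≤ ‖θ - θ₀‖ + ‖θ' - θ₀‖ := by
        rw [add_comm, norm_sub_rev θ θ₀]
        exact norm_sub_le_norm_sub_add_norm_sub θ' θ₀ θ
      have h4 : m * G * ‖θ' - θ‖ ≤
          Fintype.card A * G * m * (‖θ - θ₀‖ + ‖θ' - θ₀‖) := by
        calc m * G * ‖θ' - θ‖ ≤ 1 * (m * G) * (‖θ - θ₀‖ + ‖θ' - θ₀‖) := by
              rw [one_mul]
              gcongr
          _ ≤ Fintype.card A * (m * G) * (‖θ - θ₀‖ + ‖θ' - θ₀‖) := by gcongr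
          _ = _ := by ring
      have h5 : 0 ≤ m * G * ‖θ' - θ‖ := by positivity
      simp only [Nat.cast_one, one_pow, div_one, zero_div, zero_mul, add_zero]
      linarith [h1.1, h1.2, h2.1, h2.2]
  · have hlog : (69 : ℝ) / 100 ≤ Real.log T :=
      (by linarith [Real.log_two_gt_d9] : (69 : ℝ) / 100 ≤ Real.log 2).trans
        (Real.log_le_log (by norm_num) (by exact_mod_cast hT2))
    have hlog3 : (3 : ℝ) / 10 ≤ Real.log T ^ 3 :=
      le_trans (by norm_num) (pow_le_pow_left₀ (by norm_num) hlog 3)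
    refine ⟨22 * m ^ 2 * G ^ 2 + 6 * m * B, by positivity, ?_, fun θ₀ θ θ' =>
      ⟨0, le_rfl, by positivity, ?_⟩⟩
    · have hsqrt : 1 ≤ √(Fintype.card A : ℝ) := Real.one_le_sqrt.2 hA1
      have h1 : (1 : ℝ) * G ^ 2 * m ^ 2 * 1 * (3 / 10) ≤
          √(Fintype.card A) * G ^ 2 * m ^ 2 * M.tHit π * Real.log T ^ 3 := by gcongr
      have h2 : B * m * (69 / 100) ≤ B * m * Real.log T := by gcongr
      have h3 : 0 ≤ G ^ 2 * m ^ 2 := by positivity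
      have h4 : 0 ≤ B * m := by positivity
      linarith
    · rw [(hgrad θ).gradient]
      have h := (abs_le.1 (hbound θ θ').2).1
      linarith
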